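/- Let $A$, $B$, $E$ be finite-dimensional quantum systems, and let $\mathcal N$ be a quantum channel (completely positive trace-preserving linear map) from $A$ to $B$, with isometric dilation $U : A \to B\otimes E$, that is, $U^\dagger U = 1$ and $\mathcal N(\rho)=\mathrm{Tr}_E(U\rho U^\dagger)$. Let $\mathcal N^c(\rho)=\mathrm{Tr}_B(U\rho U^\dagger)$ be the complementary channel, and suppose that $\mathcal N$ is degradable: $\mathcal N^c=\mathcal D\circ\mathcal N$ for some quantum channel $\mathcal D$ from $B$ to $E$. Fix a Hermitian operator $H$ on $B$ and a finite family of density operators $(\rho_x)_{x\in X}$ on $A$, the signal states; fixing them, with only the input probabilities free, is what is meant here by a classical-quantum (CQ) channel. For a probability distribution $p$ on $X$ put $\rho_p=\sum_x p_x\rho_x$ and $$\chi_{AB}(p)=S(\mathcal N(\rho_p))-\sum_x p_x S(\mathcal N(\rho_x)),\qquad \chi_{AE}(p)=S(\mathcal N^c(\rho_p))-\sum_x p_x S(\mathcal N^c(\rho_x)),$$ where $S(\sigma)=-\mathrm{Tr}(\sigma\log\sigma)$ is the von Neumann entropy. Let $\mathcal B$ be the set of all real $b$ for which some probability distribution $p$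 on $X$ satisfies $\mathrm{Tr}(H\mathcal N(\rho_p))\ge b$. For $b\in\mathcal B$ the single-use private capacity-power function is $$P_1^Q(b)=\max_{p\,:\,\mathrm{Tr}(H\mathcal N(\rho_p))\ge b}\bigl(\chi_{AB}(p)-\chi_{AE}(p)\bigr).$$ Then, for every $b\in\mathcal B$, this maximum is attained; moreover $\mathcal B$ is convex and $P_1^Q$ is concave on it: for $b_1,b_2\in\mathcal B$ and $\alpha_1,\alpha_2\ge 0$ with $\alpha_1+\alpha_2=1$, $$P_1^Q(\alpha_1 b_1+\alpha_2 b_2)\ \ge\ \alpha_1P_1^Q(b_1)+\alpha_2P_1^Q(b_2).$$ -/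

import Mathlib

open scoped Matrix ComplexOrder

noncomputable section

namespace PrivateCapacityPower

/-- Density matrices: positive semidefinite complex matrices of trace one. -/
def IsDensityMatrix {A : Type*} [Fintype A] (ρ : Matrix A A ℂ) : Prop :=
  ρ.PosSemidef ∧ ρ.trace = 1

/-- The von Neumann entropy `S(ρ) = -Tr (ρ log ρ)` (natural logarithm, `0 log 0 = 0`); the matrix
logarithm is taken in the functional calculus of Hermitian matrices. -/
def entropy {A : Type*} [Fintype A] [DecidableEq A] (ρ : Matrix A A ℂ) : ℝ :=
  -(ρ * cfc Real.log ρ).trace.re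

/-- The map `id ⊗ Φ` on `n × n` block matrices: `Φ` is applied to every block. -/
def amplify {A B : Type*} (n : ℕ) (Φ : Matrix A A ℂ →ₗ[ℂ] Matrix B B ℂ)
    (M : Matrix (Fin n × A) (Fin n × A) ℂ) : Matrix (Fin n × B) (Fin n × B) ℂ :=
  Matrix.of fun r s => Φ (Matrix.of fun a a' => M (r.1, a) (s.1, a')) r.2 s.2

/-- Quantum channels: completely positive trace-preserving linear maps. -/
structure IsQuantumChannel {A B : Type*} [Fintype A] [Fintype B]
    (Φ : Matrix A A ℂ →ₗ[ℂ] Matrix B B ℂ) : Prop where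
  completelyPositive : ∀ (n : ℕ) (M : Matrix (Fin n × A) (Fin n × A) ℂ),
    M.PosSemidef → (amplify n Φ M).PosSemidef
  tracePreserving : ∀ M : Matrix A A ℂ, (Φ M).trace = M.trace

/-- The partial trace over the environment `E`. -/
def traceEnv {B E : Type*} [Fintype E] :
    Matrix (B × E) (B × E) ℂ →ₗ[ℂ] Matrix B B ℂ where
  toFun M := Matrix.of fun b b' => ∑ e, M (b, e) (b', e)
  map_add' M M' := by ext; simp [Finset.sum_add_distrib]
  map_smul' c M := by ext; simp [Finset.mul_sum]

/-- The partial trace over the output system `B`. -/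
def traceOut {B E : Type*} [Fintype B] :
    Matrix (B × E) (B × E) ℂ →ₗ[ℂ] Matrix E E ℂ where
  toFun M := Matrix.of fun e e' => ∑ b, M (b, e) (b, e')
  map_add' M M' := by ext; simp [Finset.sum_add_distrib]
  map_smul' c M := by ext; simp [Finset.mul_sum]

/-- The map `ρ ↦ U ρ U†`. -/
def conjBy {A C : Type*} [Fintype A] (U : Matrix C A ℂ) :
    Matrix A A ℂ →ₗ[ℂ] Matrix C C ℂ where
  toFun M := U * M * Uᴴ
  map_add' M M' := by rw [Matrix.mul_add, Matrix.add_mul]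
  map_smul' c M := by simp

/-- `U : A → B ⊗ E` is an isometric dilation of `N`: `U† U = 1` and
`N(ρ) = Tr_E (U ρ U†)`. -/
structure IsDilation {A B E : Type*} [Fintype A] [DecidableEq A] [Fintype B] [Fintype E]
    (N : Matrix A A ℂ →ₗ[ℂ] Matrix B B ℂ) (U : Matrix (B × E) A ℂ) : Prop where
  isometry : Uᴴ * U = 1
  dilates : N = traceEnv ∘ₗ conjBy U

/-- The complementary channel `N^c(ρ) = Tr_B (U ρ U†)` to the environment. -/
def complementary {A B E : Type*} [Fintype A] [Fintype B]
    (U : Matrix (B × E) A ℂ) : Matrix A A ℂ →ₗ[ℂ] Matrix E E ℂ :=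
  traceOut ∘ₗ conjBy U

/-- `N` with complementary channel `Nc` is degradable: `Nc = D ∘ N` for some quantum channel
`D`. -/
def IsDegradable {A B E : Type*} [Fintype B] [Fintype E]
    (N : Matrix A A ℂ →ₗ[ℂ] Matrix B B ℂ) (Nc : Matrix A A ℂ →ₗ[ℂ] Matrix E E ℂ) : Prop :=
  ∃ D : Matrix B B ℂ →ₗ[ℂ] Matrix E E ℂ, IsQuantumChannel D ∧ Nc = D ∘ₗ N

/-- The average state `∑ₓ pₓ ρₓ` of an ensemble. -/
def averageState {A X : Type*} [Fintype X] (p : X → ℝ) (ρ : X → Matrix A A ℂ) :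
    Matrix A A ℂ :=
  ∑ x, (p x : ℂ) • ρ x

/-- The Holevo quantity `S(Φ(∑ₓ pₓ ρₓ)) - ∑ₓ pₓ S(Φ(ρₓ))` of the output ensemble of `Φ`. -/
def holevo {A B X : Type*} [Fintype B] [DecidableEq B] [Fintype X]
    (Φ : Matrix A A ℂ →ₗ[ℂ] Matrix B B ℂ) (p : X → ℝ) (ρ : X → Matrix A A ℂ) : ℝ :=
  entropy (Φ (averageState p ρ)) - ∑ x, p x * entropy (Φ (ρ x))

/-- `χ_AB - χ_AE`: the Holevo quantity at the output of `N` minus that at the output of the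
complementary channel `Nc`. -/
def privateInformation {A B E X : Type*} [Fintype B] [DecidableEq B] [Fintype E] [DecidableEq E]
    [Fintype X] (N : Matrix A A ℂ →ₗ[ℂ] Matrix B B ℂ) (Nc : Matrix A A ℂ →ₗ[ℂ] Matrix E E ℂ)
    (ρ : X → Matrix A A ℂ) (p : X → ℝ) : ℝ :=
  holevo N p ρ - holevo Nc p ρ

/-- The probability distributions `p` on the fixed signal states `ρₓ` whose average output energy
`Tr (H N(∑ₓ pₓ ρₓ))` is at least `b`. -/
def admissible {A B X : Type*} [Fintype B] [Fintype X]
    (N : Matrix A A ℂ →ₗ[ℂ] Matrix B B ℂ) (H : Matrix B B ℂ) (ρ : X → Matrix A A ℂ)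
    (b : ℝ) : Set (X → ℝ) :=
  {p | p ∈ stdSimplex ℝ X ∧ b ≤ (H * N (averageState p ρ)).trace.re}

/-- The single-use private capacity-power function for the fixed signal states `ρₓ`: the optimal
value of `χ_AB - χ_AE` over the `b`-admissible input distributions. -/
def privateCapacityPower {A B E X : Type*} [Fintype B] [DecidableEq B] [Fintype E] [DecidableEq E]
    [Fintype X] (N : Matrix A A ℂ →ₗ[ℂ] Matrix B B ℂ) (Nc : Matrix A A ℂ →ₗ[ℂ] Matrix E E ℂ)
    (H : Matrix B B ℂ) (ρ : X → Matrix A A ℂ) (b : ℝ) : ℝ :=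
  sSup (privateInformation N Nc ρ '' admissible N H ρ b)

end PrivateCapacityPower

end

/-! With the complementary channel equal to `D ∘ N`, the private information is `S(N ρ_p) - S(D (N
ρ_p))` plus terms linear in `p`, so concavity in `p` reduces to concavity of `σ ↦ S(σ) - S(D σ)`. By
`sum_relativeEntropy`, the concavity gap of the entropy at `σ = a ρ₁ + b ρ₂` is the weighted sum of
the relative entropies of `ρ₁`, `ρ₂` to `σ`; data processing says that it cannot grow under `D`.

Data processing (`relativeEntropy_le`) is proved by writing relative entropy as an integral over `s`
of the quadratic forms `⟨ρ - σ, (L_σ + s R_ρ)⁻¹ (ρ - σ)⟩`. Each form is a supremum of functionals of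
a matrix `Y`; pulling a test matrix back by the adjoint channel only increases the functional, by
the Kadison–Schwarz inequality.

Maxima exist because the admissible set is compact and entropy is continuous. Mixing optimal
distributions for `b₁` and `b₂` gives an admissible one for the mixed bound, hence the concavity of
the capacity-power function. -/

namespace PrivateCapacityPower

open MeasureTheory Set Filter Topology

/-! ### Scalar integral behind the relative entropy. -/

/-- The primitive comes from partial fractions. Keeping the logarithm of a quotient gives it a
finite limit at infinity. -/
theorem hasDerivAt_divergence_primitive {a b s : ℝ} (ha : 0 < a) (hb : 0 ≤ b) (hs : 0 ≤ s) :
    HasDerivAt (fun s => b * Real.log ((a + s * b) / (1 + s)) - (a - b) / (1 + s))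
      ((b - a) ^ 2 / (a + s * b) / (1 + s) ^ 2) s := by
  have h1 : 0 < 1 + s := by positivity
  have h2 : 0 < a + s * b := by positivity
  have d1 : HasDerivAt (fun s : ℝ => 1 + s) 1 s := (hasDerivAt_id s).const_add 1
  have d2 : HasDerivAt (fun s : ℝ => a + s * b) b s := by
    simpa using ((hasDerivAt_id s).mul_const b).const_add a
  have d3 := ((d2.div d1 h1.ne').log (div_pos h2 h1).ne').const_mul b
  have d4 := (hasDerivAt_const s (a - b)).div d1 h1.ne'
  refine (d3.sub d4).congr_deriv ?_
  rw [Pi.div_apply]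
  field_simp
  ring

theorem tendsto_divergence_primitive {a b : ℝ} (hb : 0 ≤ b) :
    Tendsto (fun s : ℝ => b * Real.log ((a + s * b) / (1 + s)) - (a - b) / (1 + s)) atTop
      (𝓝 (b * Real.log b)) := by
  have t1 : Tendsto (fun s : ℝ => 1 + s) atTop atTop := tendsto_atTop_add_const_left _ _ tendsto_id
  have t2 : Tendsto (fun s : ℝ => (a - b) / (1 + s)) atTop (𝓝 0) := t1.const_div_atTop _
  have t3 : Tendsto (fun s : ℝ => (a + s * b) / (1 + s)) atTop (𝓝 b) := by
    have : Tendsto (fun s : ℝ => b + (a - b) / (1 + s)) atTop (𝓝 (b + 0)) := t2.const_add b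
    rw [add_zero] at this
    refine this.congr' ?_
    filter_upwards [eventually_gt_atTop 0] with s hs
    field_simp
    ring
  rcases hb.eq_or_lt with rfl | hb'
  · simpa using t2.neg
  · simpa using ((t3.log hb'.ne').const_mul b).sub t2

/-- For `a = 0 < b` the integrand behaves like `b / s` near `0`; `hab` excludes this case. -/
theorem integrableOn_divergence {a b : ℝ} (ha : 0 ≤ a) (hb : 0 ≤ b) (hab : a = 0 → b = 0) :
    IntegrableOn (fun s => (b - a) ^ 2 / (a + s * b) / (1 + s) ^ 2) (Ioi 0) := by
  rcases ha.eq_or_lt with rfl | ha'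
  · simp [hab rfl]
  · refine integrableOn_Ioi_deriv_of_nonneg'
      (fun s hs => hasDerivAt_divergence_primitive ha' hb hs) (fun s hs => ?_)
      (tendsto_divergence_primitive hb)
    have : (0 : ℝ) < s := hs
    positivity

/-- The integral representation of the summand of the relative entropy. -/
theorem integral_divergence {a b : ℝ} (ha : 0 ≤ a) (hb : 0 ≤ b) (hab : a = 0 → b = 0) :
    ∫ s in Ioi 0, (b - a) ^ 2 / (a + s * b) / (1 + s) ^ 2
      = b * Real.log b - b * Real.log a + a - b := by
  rcases ha.eq_or_lt with rfl | ha'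
  · simp [hab rfl]
  · rw [integral_Ioi_of_hasDerivAt_of_nonneg'
      (fun s hs => hasDerivAt_divergence_primitive ha' hb hs) (fun s hs => ?_)
      (tendsto_divergence_primitive hb)]
    · simp
      ring
    · have : (0 : ℝ) < s := hs
      positivity

/-! ### Variational and integral formulas for the relative entropy. -/

section RelativeEntropy

variable {n : Type*} [Fintype n] [DecidableEq n]

/-- The matrix with orthonormal eigenvectors the columns of `V` and real eigenvalues `b`. -/
noncomputable def diagonalConj (V : Matrix n n ℂ) (b : n → ℝ) : Matrix n n ℂ :=
  V * Matrix.diagonal (fun i => (b i : ℂ)) * Vᴴ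

theorem exists_diagonalConj {M : Matrix n n ℂ} (hM : M.IsHermitian) :
    ∃ (V : Matrix n n ℂ) (b : n → ℝ), Vᴴ * V = 1 ∧ V * Vᴴ = 1 ∧ M = diagonalConj V b ∧
      (M.PosSemidef → ∀ i, 0 ≤ b i) ∧ ∀ f : ℝ → ℝ, cfc f M = diagonalConj V (f ∘ b) := by
  refine ⟨hM.eigenvectorUnitary, hM.eigenvalues, ?_, ?_, ?_, fun h => h.eigenvalues_nonneg,
    fun f => ?_⟩
  · exact Unitary.coe_star_mul_self hM.eigenvectorUnitary
  · exact Unitary.coe_mul_star_self hM.eigenvectorUnitary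
  · conv_lhs => rw [hM.spectral_theorem]
    rfl
  · rw [hM.cfc_eq]
    rfl

theorem trace_diagonal_mul_re (b : n → ℝ) (M : Matrix n n ℂ) :
    (Matrix.diagonal (fun i => (b i : ℂ)) * M).trace.re = ∑ i, b i * (M i i).re := by
  simp [Matrix.trace, Matrix.diagonal_mul]

theorem trace_diagonalConj_mul_re (V : Matrix n n ℂ) (b : n → ℝ) (Y : Matrix n n ℂ) :
    (diagonalConj V b * Y).trace.re = ∑ i, b i * ((Vᴴ * Y * V) i i).re := by
  rw [← trace_diagonal_mul_re, diagonalConj]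
  congr 1
  rw [Matrix.mul_assoc, Matrix.mul_assoc, Matrix.trace_mul_comm, Matrix.mul_assoc]

omit [DecidableEq n] in
theorem mul_conjTranspose_apply_self_re {m : Type*} (T : Matrix m n ℂ) (i : m) :
    ((T * Tᴴ) i i).re = ∑ j, ‖T i j‖ ^ 2 := by
  simp [Matrix.mul_apply, Complex.mul_conj, Complex.normSq_eq_norm_sq, -Complex.ofReal_pow]

theorem trace_diagonalConj_mul_diagonalConj_re (V W : Matrix n n ℂ) (b a : n → ℝ) :
    (diagonalConj V b * diagonalConj W a).trace.re
      = ∑ i, ∑ j, ‖(Wᴴ * V) i j‖ ^ 2 * (b j * a i) := by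
  rw [trace_diagonalConj_mul_re, Finset.sum_comm]
  refine Finset.sum_congr rfl fun j _ => ?_
  have : Vᴴ * diagonalConj W a * V
      = (Wᴴ * V)ᴴ * Matrix.diagonal (fun i => (a i : ℂ)) * (Wᴴ * V) := by
    simp [diagonalConj, Matrix.mul_assoc]
  rw [this, Matrix.mul_apply, Complex.re_sum, Finset.mul_sum]
  refine Finset.sum_congr rfl fun i _ => ?_
  rw [Matrix.mul_diagonal, Matrix.conjTranspose_apply, mul_right_comm, RCLike.star_def,
    Complex.conj_mul', ← Complex.ofReal_pow, ← Complex.ofReal_mul, Complex.ofReal_re]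
  ring

theorem sum_norm_sq_row {u : Matrix n n ℂ} (hu : u * uᴴ = 1) (i : n) : ∑ j, ‖u i j‖ ^ 2 = 1 := by
  rw [← mul_conjTranspose_apply_self_re, hu]
  simp

theorem sum_norm_sq_col {u : Matrix n n ℂ} (hu : uᴴ * u = 1) (j : n) : ∑ i, ‖u i j‖ ^ 2 = 1 := by
  have := sum_norm_sq_row (u := uᴴ) (by simpa using hu) j
  simpa using this

theorem trace_diagonalConj_mul_self_re {V : Matrix n n ℂ} (hV : Vᴴ * V = 1) (b c : n → ℝ) :
    (diagonalConj V b * diagonalConj V c).trace.re = ∑ j, b j * c j := by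
  rw [trace_diagonalConj_mul_re]
  refine Finset.sum_congr rfl fun j _ => ?_
  have : Vᴴ * diagonalConj V c * V = Matrix.diagonal (fun i => (c i : ℂ)) := by
    rw [diagonalConj, Matrix.mul_assoc V, ← Matrix.mul_assoc, hV, Matrix.one_mul,
      Matrix.mul_assoc, hV, Matrix.mul_one]
  simp [this]

theorem trace_diagonalConj_re {V : Matrix n n ℂ} (hV : Vᴴ * V = 1) (b : n → ℝ) :
    (diagonalConj V b).trace.re = ∑ j, b j := by
  have := trace_diagonalConj_mul_re V b 1
  rw [Matrix.mul_one] at this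
  simp [this, hV]

theorem diagonalConj_mul_sum {W V : Matrix n n ℂ} (hW : W * Wᴴ = 1) (hV : V * Vᴴ = 1)
    (hW' : Wᴴ * W = 1) (hV' : Vᴴ * V = 1) :
    (∀ i, ∑ j, ‖(Wᴴ * V) i j‖ ^ 2 = 1) ∧ ∀ j, ∑ i, ‖(Wᴴ * V) i j‖ ^ 2 = 1 := by
  refine ⟨sum_norm_sq_row ?_, sum_norm_sq_col ?_⟩
  · rw [Matrix.conjTranspose_mul, Matrix.conjTranspose_conjTranspose, Matrix.mul_assoc,
      ← Matrix.mul_assoc V, hV, Matrix.one_mul, hW']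
  · rw [Matrix.conjTranspose_mul, Matrix.conjTranspose_conjTranspose, Matrix.mul_assoc,
      ← Matrix.mul_assoc W, hW, Matrix.one_mul, hV']

/-- The functional whose supremum over `Y` is the `χ²`-type divergence
`⟨ρ - σ, (L_σ + s R_ρ)⁻¹ (ρ - σ)⟩`. -/
noncomputable def divergenceFunctional {m : Type*} [Fintype m] (s : ℝ) (ρ σ Y : Matrix m m ℂ) : ℝ :=
  2 * ((ρ - σ) * Y).trace.re - (σ * (Yᴴ * Y)).trace.re - s * (ρ * (Y * Yᴴ)).trace.re

/-- The divergence `⟨ρ - σ, (L_σ + s R_ρ)⁻¹ (ρ - σ)⟩`. -/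
noncomputable def resolventDivergence {m : Type*} [Fintype m] (s : ℝ) (ρ σ : Matrix m m ℂ) : ℝ :=
  ⨆ Y, divergenceFunctional s ρ σ Y

/-- In the two eigenbases the functional decouples into one scalar quadratic for each pair of
eigenvectors. -/
theorem divergenceFunctional_diagonalConj {W V : Matrix n n ℂ}
    (hW' : Wᴴ * W = 1) (hV' : Vᴴ * V = 1) (s : ℝ) (a b : n → ℝ) (T : Matrix n n ℂ) :
    divergenceFunctional s (diagonalConj V b) (diagonalConj W a) (V * T * Wᴴ)
      = ∑ i, ∑ j, (2 * (b j - a i) * ((Wᴴ * V) i j * T j i).re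
          - (a i + s * b j) * ‖T j i‖ ^ 2) := by
  set u := Wᴴ * V with hu
  have e1 : Vᴴ * (V * T * Wᴴ) * V = T * u := by
    rw [hu, Matrix.mul_assoc V, ← Matrix.mul_assoc Vᴴ, hV', Matrix.one_mul, Matrix.mul_assoc]
  have e2 : Wᴴ * (V * T * Wᴴ) * W = u * T := by
    rw [hu, Matrix.mul_assoc, Matrix.mul_assoc _ Wᴴ W, hW', Matrix.mul_one, Matrix.mul_assoc]
  have e3 : Vᴴ * ((V * T * Wᴴ) * (V * T * Wᴴ)ᴴ) * V = T * Tᴴ := by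
    calc _ = (Vᴴ * V) * T * (Wᴴ * W) * Tᴴ * (Vᴴ * V) := by simp [Matrix.mul_assoc]
      _ = _ := by simp [hV', hW']
  have e4 : Wᴴ * ((V * T * Wᴴ)ᴴ * (V * T * Wᴴ)) * W = Tᴴ * Tᴴᴴ := by
    calc _ = (Wᴴ * W) * Tᴴ * (Vᴴ * V) * T * (Wᴴ * W) := by simp [Matrix.mul_assoc]
      _ = _ := by simp [hV', hW']
  have e5 : ∑ j, b j * ((T * u) j j).re = ∑ i, ∑ j, b j * (u i j * T j i).re := by
    rw [Finset.sum_comm]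
    simp only [Matrix.mul_apply, Complex.re_sum, Finset.mul_sum, mul_comm]
  have e6 : ∑ j, b j * (∑ i, ‖T j i‖ ^ 2) = ∑ i, ∑ j, b j * ‖T j i‖ ^ 2 := by
    rw [Finset.sum_comm]
    simp only [Finset.mul_sum]
  rw [divergenceFunctional, Matrix.sub_mul, Matrix.trace_sub, Complex.sub_re]
  simp only [trace_diagonalConj_mul_re, e1, e2, e3, e4, e5, mul_conjTranspose_apply_self_re, e6]
  simp only [Matrix.mul_apply, Complex.re_sum, Finset.mul_sum, ← Finset.sum_sub_distrib,
    Matrix.conjTranspose_apply, norm_star]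
  refine Finset.sum_congr rfl fun i _ => Finset.sum_congr rfl fun j _ => ?_
  ring

/-- Completing the square. For `c = 0` the linear term must vanish too, matching `d ^ 2 / 0 = 0`. -/
theorem quadratic_le_div {c d : ℝ} (hc : 0 ≤ c) (hcd : c = 0 → d = 0) (u t : ℂ) :
    2 * d * (u * t).re - c * ‖t‖ ^ 2 ≤ ‖u‖ ^ 2 * (d ^ 2 / c) := by
  rcases hc.eq_or_lt with rfl | hc'
  · simp [hcd rfl]
  · have h1 : d * (u * t).re ≤ |d| * (‖u‖ * ‖t‖) := by
      rw [← norm_mul]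
      calc _ ≤ |d * (u * t).re| := le_abs_self _
        _ = |d| * |(u * t).re| := abs_mul _ _
        _ ≤ _ := by gcongr; exact Complex.abs_re_le_norm _
    have h2 : ‖u‖ ^ 2 * (d ^ 2 / c) + c * ‖t‖ ^ 2 - 2 * (|d| * (‖u‖ * ‖t‖))
        = (‖u‖ * |d| - c * ‖t‖) ^ 2 / c := by
      field_simp
      rw [← sq_abs d]
      ring
    have h3 : 0 ≤ (‖u‖ * |d| - c * ‖t‖) ^ 2 / c := by positivity
    linarith

theorem quadratic_eq_div {c d : ℝ} (u : ℂ) :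
    2 * d * (u * (starRingEnd ℂ u * ((d / c : ℝ) : ℂ))).re
      - c * ‖starRingEnd ℂ u * ((d / c : ℝ) : ℂ)‖ ^ 2 = ‖u‖ ^ 2 * (d ^ 2 / c) := by
  rw [← mul_assoc, Complex.mul_conj', ← Complex.ofReal_pow, ← Complex.ofReal_mul,
    Complex.ofReal_re, norm_mul, Complex.norm_real, RCLike.norm_conj, mul_pow, Real.norm_eq_abs,
    sq_abs]
  rcases eq_or_ne c 0 with rfl | hc
  · simp
  · field_simp
    ring

theorem isGreatest_divergenceFunctional {W V : Matrix n n ℂ} (hW : W * Wᴴ = 1) (hV : V * Vᴴ = 1)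
    (hW' : Wᴴ * W = 1) (hV' : Vᴴ * V = 1) {s : ℝ} (hs : 0 < s) {a b : n → ℝ}
    (ha : ∀ i, 0 ≤ a i) (hb : ∀ i, 0 ≤ b i) :
    IsGreatest (range (divergenceFunctional s (diagonalConj V b) (diagonalConj W a)))
      (∑ i, ∑ j, ‖(Wᴴ * V) i j‖ ^ 2 * ((b j - a i) ^ 2 / (a i + s * b j))) := by
  -- The witness collects the maximizers of the scalar quadratics, one per entry.
  refine ⟨⟨V * (Matrix.of fun j i => starRingEnd ℂ ((Wᴴ * V) i j) *
    (((b j - a i) / (a i + s * b j) : ℝ) : ℂ)) * Wᴴ, ?_⟩, ?_⟩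
  · rw [divergenceFunctional_diagonalConj hW' hV']
    refine Finset.sum_congr rfl fun i _ => Finset.sum_congr rfl fun j _ => ?_
    exact quadratic_eq_div _
  · rintro _ ⟨Y, rfl⟩
    have hY : Y = V * (Vᴴ * Y * W) * Wᴴ := by
      calc Y = (V * Vᴴ) * Y * (W * Wᴴ) := by simp [hV, hW]
        _ = _ := by simp only [Matrix.mul_assoc]
    rw [hY, divergenceFunctional_diagonalConj hW' hV']
    refine Finset.sum_le_sum fun i _ => Finset.sum_le_sum fun j _ => ?_
    have h1 := ha i
    have h2 : 0 ≤ s * b j := mul_nonneg hs.le (hb j)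
    refine quadratic_le_div (by positivity) (fun h => ?_) _ _
    have h3 : a i = 0 := by linarith
    have h4 : s * b j = 0 := by linarith
    rw [h3, (mul_eq_zero.mp h4).resolve_left hs.ne', sub_zero]

/-- Boundedness is what makes `⨆` in `resolventDivergence` a true supremum rather than the default
`0`. -/
theorem bddAbove_divergenceFunctional {ρ σ : Matrix n n ℂ} (hρ : ρ.PosSemidef)
    (hσ : σ.PosSemidef) {s : ℝ} (hs : 0 < s) :
    BddAbove (range (divergenceFunctional s ρ σ)) := by
  obtain ⟨V, b, hV', hV, rfl, hb, -⟩ := exists_diagonalConj hρ.1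
  obtain ⟨W, a, hW', hW, rfl, ha, -⟩ := exists_diagonalConj hσ.1
  exact (isGreatest_divergenceFunctional hW hV hW' hV' hs (ha hσ) (hb hρ)).bddAbove

/-- The quantum relative entropy `Tr ρ (log ρ - log σ)`. -/
noncomputable def relativeEntropy (ρ σ : Matrix n n ℂ) : ℝ :=
  (ρ * cfc Real.log ρ).trace.re - (ρ * cfc Real.log σ).trace.re

/-- The integral representation of the relative entropy, for states `ρ` dominated by a multiple
of `σ`. -/
theorem relativeEntropy_integral {ρ σ : Matrix n n ℂ} (hρ : ρ.PosSemidef)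
    (hσ : σ.PosSemidef) {c : ℝ} (hc : 0 < c) (hle : (σ - (c : ℂ) • ρ).PosSemidef) :
    IntegrableOn (fun s => resolventDivergence s ρ σ / (1 + s) ^ 2) (Ioi 0) ∧
      ∫ s in Ioi 0, resolventDivergence s ρ σ / (1 + s) ^ 2
        = relativeEntropy ρ σ + σ.trace.re - ρ.trace.re := by
  obtain ⟨V, b, hV', hV, hρV, hb, hfρ⟩ := exists_diagonalConj hρ.1
  obtain ⟨W, a, hW', hW, hσW, ha, hfσ⟩ := exists_diagonalConj hσ.1
  replace hb := hb hρ
  replace ha := ha hσ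
  obtain ⟨hrow, hcol⟩ := diagonalConj_mul_sum hW hV hW' hV'
  set u := Wᴴ * V with hu
  -- Diagonal entry `i` of `Wᴴ (σ - c ρ) W` is `a i - c ∑ j, ‖u i j‖ ^ 2 * b j ≥ 0`. The resulting
  -- support inclusion makes the convention `log 0 = 0` harmless.
  have hsupp : ∀ i j, u i j ≠ 0 → a i = 0 → b j = 0 := by
    intro i j huij hai
    have h1 := (hle.conjTranspose_mul_mul_same W).diag_nonneg (i := i)
    have h2 : Wᴴ * (σ - (c : ℂ) • ρ) * W = Matrix.diagonal (fun i => (a i : ℂ))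
        - (c : ℂ) • (u * Matrix.diagonal (fun i => (b i : ℂ)) * uᴴ) := by
      calc _ = (Wᴴ * W) * Matrix.diagonal (fun i => (a i : ℂ)) * (Wᴴ * W) - (c : ℂ) •
            (u * Matrix.diagonal (fun i => (b i : ℂ)) * uᴴ) := by
            rw [hσW, hρV]
            simp [diagonalConj, hu, Matrix.mul_assoc, Matrix.mul_sub, Matrix.sub_mul]
        _ = _ := by simp [hW']
    have h3 : (u * Matrix.diagonal (fun i => (b i : ℂ)) * uᴴ) i i
        = ((∑ j, ‖u i j‖ ^ 2 * b j : ℝ) : ℂ) := by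
      rw [Matrix.mul_apply, Complex.ofReal_sum]
      refine Finset.sum_congr rfl fun j _ => ?_
      rw [Matrix.mul_diagonal, Matrix.conjTranspose_apply, mul_right_comm, RCLike.star_def,
        Complex.mul_conj']
      push_cast
      ring
    rw [h2, Matrix.sub_apply, Matrix.smul_apply, h3, Matrix.diagonal_apply_eq, hai,
      smul_eq_mul, ← Complex.ofReal_mul, ← Complex.ofReal_sub, Complex.zero_le_real] at h1
    have h4 : 0 ≤ ‖u i j‖ ^ 2 * b j := mul_nonneg (sq_nonneg _) (hb j)
    have h5 : ‖u i j‖ ^ 2 * b j ≤ ∑ j, ‖u i j‖ ^ 2 * b j :=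
      Finset.single_le_sum (f := fun j => ‖u i j‖ ^ 2 * b j)
        (fun j _ => mul_nonneg (sq_nonneg _) (hb j)) (Finset.mem_univ j)
    have h6 : c * ∑ j, ‖u i j‖ ^ 2 * b j ≤ 0 := by linarith
    have h7 : ∑ j, ‖u i j‖ ^ 2 * b j ≤ 0 := by
      by_contra! h
      linarith [mul_pos hc h]
    have h8 : ‖u i j‖ ^ 2 * b j = 0 := by linarith
    simpa [huij] using h8
  have hterm : ∀ i j,
      IntegrableOn (fun s => ‖u i j‖ ^ 2 * ((b j - a i) ^ 2 / (a i + s * b j) / (1 + s) ^ 2))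
        (Ioi 0) ∧
      ∫ s in Ioi 0, ‖u i j‖ ^ 2 * ((b j - a i) ^ 2 / (a i + s * b j) / (1 + s) ^ 2)
        = ‖u i j‖ ^ 2 * (b j * Real.log (b j) - b j * Real.log (a i) + a i - b j) := by
    intro i j
    by_cases huij : u i j = 0
    · simp [huij]
    · rw [integral_const_mul, integral_divergence (ha i) (hb j) (hsupp i j huij)]
      exact ⟨(integrableOn_divergence (ha i) (hb j) (hsupp i j huij)).const_mul _, rfl⟩
  have heq : EqOn (fun s => resolventDivergence s ρ σ / (1 + s) ^ 2)
      (fun s => ∑ i, ∑ j, ‖u i j‖ ^ 2 * ((b j - a i) ^ 2 / (a i + s * b j) / (1 + s) ^ 2))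
      (Ioi 0) := by
    intro s hs
    have := (isGreatest_divergenceFunctional hW hV hW' hV' hs ha hb).csSup_eq
    rw [← hρV, ← hσW] at this
    simp only [resolventDivergence, iSup, this, Finset.sum_div, mul_div_assoc, hu]
  have hint : ∀ i, IntegrableOn
      (fun s => ∑ j, ‖u i j‖ ^ 2 * ((b j - a i) ^ 2 / (a i + s * b j) / (1 + s) ^ 2)) (Ioi 0) :=
    fun i => integrable_finsetSum _ fun j _ => (hterm i j).1
  refine ⟨?_, ?_⟩
  · rw [integrableOn_congr_fun heq measurableSet_Ioi]
    exact integrable_finsetSum _ fun i _ => hint i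
  · rw [setIntegral_congr_fun measurableSet_Ioi heq, integral_finsetSum _ fun i _ => hint i]
    -- The weights `‖u i j‖ ^ 2` are doubly stochastic, so every single-basis trace is also a double
    -- sum.
    have h1 : (ρ * cfc Real.log ρ).trace.re = ∑ i, ∑ j, ‖u i j‖ ^ 2 * (b j * Real.log (b j)) := by
      rw [hfρ, hρV, trace_diagonalConj_mul_self_re hV', Finset.sum_comm]
      simp only [← Finset.sum_mul, hcol, one_mul, Function.comp]
    have h2 : (ρ * cfc Real.log σ).trace.re = ∑ i, ∑ j, ‖u i j‖ ^ 2 * (b j * Real.log (a i)) := by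
      rw [hfσ, hρV, trace_diagonalConj_mul_diagonalConj_re]
      rfl
    have h3 : ρ.trace.re = ∑ i, ∑ j, ‖u i j‖ ^ 2 * b j := by
      rw [hρV, trace_diagonalConj_re hV', Finset.sum_comm]
      simp only [← Finset.sum_mul, hcol, one_mul]
    have h4 : σ.trace.re = ∑ i, ∑ j, ‖u i j‖ ^ 2 * a i := by
      rw [hσW, trace_diagonalConj_re hW']
      simp only [← Finset.sum_mul, hrow, one_mul]
    rw [relativeEntropy, h1, h2, h3, h4]
    simp only [← Finset.sum_sub_distrib, ← Finset.sum_add_distrib]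
    refine Finset.sum_congr rfl fun i _ => ?_
    rw [integral_finsetSum _ fun j _ => (hterm i j).1]
    refine Finset.sum_congr rfl fun j _ => ?_
    rw [(hterm i j).2]
    ring

end RelativeEntropy

variable {A B : Type*} [Fintype A] [Fintype B]

/-! ### Kadison–Schwarz inequality and data processing. -/

section Channel

variable {Φ : Matrix A A ℂ →ₗ[ℂ] Matrix B B ℂ}

theorem IsQuantumChannel.map_posSemidef (hΦ : IsQuantumChannel Φ) {M : Matrix A A ℂ}
    (hM : M.PosSemidef) : (Φ M).PosSemidef :=
  (hΦ.completelyPositive 1 (M.submatrix Prod.snd Prod.snd) (hM.submatrix _)).submatrix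
    (fun b => ((0 : Fin 1), b))

/-- The block matrix with blocks `Φ (K r * σ * (K s)ᴴ)` is positive semidefinite. -/
theorem IsQuantumChannel.posSemidef_block (hΦ : IsQuantumChannel Φ) {σ : Matrix A A ℂ}
    (hσ : σ.PosSemidef) {n : ℕ} (K : Fin n → Matrix A A ℂ) :
    (Matrix.of fun r s : Fin n × B => Φ (K r.1 * σ * (K s.1)ᴴ) r.2 s.2).PosSemidef :=
  hΦ.completelyPositive n _ (hσ.mul_mul_conjTranspose_same
    (Matrix.of fun (r : Fin n × A) (c : A) => K r.1 r.2 c))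

theorem IsQuantumChannel.sum_trace_nonneg (hΦ : IsQuantumChannel Φ) {σ : Matrix A A ℂ}
    (hσ : σ.PosSemidef) {n : ℕ} (K : Fin n → Matrix A A ℂ) (J : Fin n → Matrix B B ℂ) :
    0 ≤ ∑ r, ∑ s, ((J r)ᴴ * Φ (K r * σ * (K s)ᴴ) * J s).trace.re := by
  have h := ((hΦ.posSemidef_block hσ K).conjTranspose_mul_mul_same
    (Matrix.of fun (r : Fin n × B) (c : B) => J r.1 r.2 c)).trace_nonneg
  have h' := (Complex.le_def.mp h).1
  rw [Complex.zero_re] at h'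
  convert h' using 1
  simp only [← Complex.re_sum, ← Matrix.trace_sum]
  congr 2
  ext b b'
  simp only [Matrix.sum_apply, Matrix.mul_apply, Fintype.sum_prod_type, Matrix.of_apply,
    Matrix.conjTranspose_apply, Finset.sum_mul]
  rw [Finset.sum_comm]
  refine Finset.sum_congr rfl fun s _ => ?_
  rw [Finset.sum_comm]

/-- The off-diagonal blocks of a Hermitian block matrix are mutually adjoint; here they are `Φ W`
and `Φ Wᴴ`. -/
theorem IsQuantumChannel.map_conjTranspose [DecidableEq A] (hΦ : IsQuantumChannel Φ)
    (W : Matrix A A ℂ) : Φ Wᴴ = (Φ W)ᴴ := by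
  have h := (hΦ.posSemidef_block Matrix.PosSemidef.one ![1, Wᴴ]).1
  ext b b'
  have := h.apply (1, b) (0, b')
  simpa using this.symm

/-- The adjoint of a linear map for the trace pairing, the Heisenberg picture of a channel. -/
def traceAdjoint [DecidableEq A] (Φ : Matrix A A ℂ →ₗ[ℂ] Matrix B B ℂ) (Z : Matrix B B ℂ) :
    Matrix A A ℂ :=
  Matrix.of fun a a' => (Φ (Matrix.single a' a 1) * Z).trace

theorem trace_mul_traceAdjoint [DecidableEq A] (Φ : Matrix A A ℂ →ₗ[ℂ] Matrix B B ℂ)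
    (W : Matrix A A ℂ) (Z : Matrix B B ℂ) :
    (W * traceAdjoint Φ Z).trace = (Φ W * Z).trace := by
  conv_rhs => rw [Matrix.matrix_eq_sum_single W]
  simp only [map_sum, Matrix.sum_mul, Matrix.trace_sum]
  simp only [Matrix.trace, Matrix.diag, Matrix.mul_apply (M := W)]
  refine Finset.sum_congr rfl fun a _ => Finset.sum_congr rfl fun a' _ => ?_
  have : Matrix.single a a' (W a a') = W a a' • Matrix.single a a' (1 : ℂ) := by simp
  rw [this, map_smul, Matrix.smul_mul]
  simp [traceAdjoint, Matrix.trace, Finset.mul_sum]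

theorem IsQuantumChannel.traceAdjoint_conjTranspose [DecidableEq A] (hΦ : IsQuantumChannel Φ)
    (Z : Matrix B B ℂ) : traceAdjoint Φ Zᴴ = (traceAdjoint Φ Z)ᴴ := by
  ext a a'
  have : Matrix.single a' a (1 : ℂ) = (Matrix.single a a' (1 : ℂ))ᴴ := by simp
  simp only [traceAdjoint, Matrix.of_apply, Matrix.conjTranspose_apply]
  rw [this, hΦ.map_conjTranspose, ← Matrix.conjTranspose_mul, Matrix.trace_conjTranspose,
    Matrix.trace_mul_comm]

/-- The Kadison–Schwarz inequality for the adjoint of a channel. -/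
theorem IsQuantumChannel.schwarz [DecidableEq A] [DecidableEq B] (hΦ : IsQuantumChannel Φ)
    {σ : Matrix A A ℂ} (hσ : σ.PosSemidef) (Z : Matrix B B ℂ) :
    (σ * (traceAdjoint Φ Z * (traceAdjoint Φ Z)ᴴ)).trace.re ≤ (Φ σ * (Z * Zᴴ)).trace.re := by
  -- With `Y` the adjoint image of `Z`, both cross terms equal `-Tr (Yᴴ σ Y)`, and trace
  -- preservation makes the last term `+Tr (Yᴴ σ Y)`.
  have h := hΦ.sum_trace_nonneg hσ ![1, -(traceAdjoint Φ Z)ᴴ] ![Z, 1]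
  set Y := traceAdjoint Φ Z with hY
  simp only [Fin.sum_univ_two, Matrix.cons_val_zero, Matrix.cons_val_one,
    Matrix.conjTranspose_one, Matrix.one_mul, Matrix.mul_one, Matrix.conjTranspose_neg,
    Matrix.conjTranspose_conjTranspose, Matrix.mul_neg, Matrix.neg_mul, neg_neg, map_neg,
    Matrix.trace_neg, Complex.neg_re, hΦ.tracePreserving] at h
  have e1 : (Φ (Yᴴ * σ) * Z).trace = (Yᴴ * σ * Y).trace := by rw [hY, trace_mul_traceAdjoint]
  have e2 : (Zᴴ * Φ (σ * Y)).trace.re = (Yᴴ * σ * Y).trace.re := by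
    have : Zᴴ * Φ (σ * Y) = (Φ (Yᴴ * σ) * Z)ᴴ := by
      rw [Matrix.conjTranspose_mul, ← hΦ.map_conjTranspose, Matrix.conjTranspose_mul, hσ.1.eq,
        Matrix.conjTranspose_conjTranspose]
    rw [this, Matrix.trace_conjTranspose, e1]
    simp
  have e3 : (Zᴴ * Φ σ * Z).trace = (Φ σ * (Z * Zᴴ)).trace := by
    rw [Matrix.mul_assoc, Matrix.trace_mul_comm, Matrix.mul_assoc]
  have e4 : (Yᴴ * σ * Y).trace = (σ * (Y * Yᴴ)).trace := by
    rw [Matrix.mul_assoc, Matrix.trace_mul_comm, Matrix.mul_assoc]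
  rw [e1, e2, e3, e4] at h
  linarith

variable [DecidableEq A] [DecidableEq B]

/-- The linear term is unchanged by duality; Schwarz for `Z` with `ρ` and for `Zᴴ` with `σ` handles
the two quadratic terms. -/
theorem IsQuantumChannel.divergenceFunctional_le (hΦ : IsQuantumChannel Φ) {s : ℝ} (hs : 0 < s)
    {ρ σ : Matrix A A ℂ} (hρ : ρ.PosSemidef) (hσ : σ.PosSemidef) (Z : Matrix B B ℂ) :
    divergenceFunctional s (Φ ρ) (Φ σ) Z ≤ divergenceFunctional s ρ σ (traceAdjoint Φ Z) := by
  have h1 := hΦ.schwarz hρ Z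
  have h2 := hΦ.schwarz hσ Zᴴ
  rw [hΦ.traceAdjoint_conjTranspose, Matrix.conjTranspose_conjTranspose,
    Matrix.conjTranspose_conjTranspose] at h2
  rw [divergenceFunctional, divergenceFunctional, ← map_sub, ← trace_mul_traceAdjoint]
  have h3 := mul_le_mul_of_nonneg_left h1 hs.le
  linarith

theorem IsQuantumChannel.resolventDivergence_le (hΦ : IsQuantumChannel Φ) {s : ℝ} (hs : 0 < s)
    {ρ σ : Matrix A A ℂ} (hρ : ρ.PosSemidef) (hσ : σ.PosSemidef) :
    resolventDivergence s (Φ ρ) (Φ σ) ≤ resolventDivergence s ρ σ :=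
  ciSup_le fun Z => (hΦ.divergenceFunctional_le hs hρ hσ Z).trans
    (le_ciSup (bddAbove_divergenceFunctional hρ hσ hs) _)

/-- Data processing: the relative entropy does not increase under quantum channels. -/
theorem IsQuantumChannel.relativeEntropy_le (hΦ : IsQuantumChannel Φ) {ρ σ : Matrix A A ℂ}
    (hρ : ρ.PosSemidef) (hσ : σ.PosSemidef) {c : ℝ} (hc : 0 < c)
    (hle : (σ - (c : ℂ) • ρ).PosSemidef) :
    relativeEntropy (Φ ρ) (Φ σ) ≤ relativeEntropy ρ σ := by
  have hle' : (Φ σ - (c : ℂ) • Φ ρ).PosSemidef := by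
    rw [← map_smul, ← map_sub]
    exact hΦ.map_posSemidef hle
  obtain ⟨hi, he⟩ := relativeEntropy_integral hρ hσ hc hle
  obtain ⟨hi', he'⟩ := relativeEntropy_integral (hΦ.map_posSemidef hρ) (hΦ.map_posSemidef hσ) hc hle'
  have := setIntegral_mono_on hi' hi measurableSet_Ioi fun s hs =>
    div_le_div_of_nonneg_right (hΦ.resolventDivergence_le hs hρ hσ) (sq_nonneg (1 + s))
  rw [he, he', hΦ.tracePreserving, hΦ.tracePreserving] at this
  linarith

theorem sum_relativeEntropy (ρ₁ ρ₂ : Matrix A A ℂ) (a b : ℝ) :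
    a * relativeEntropy ρ₁ ((a : ℂ) • ρ₁ + (b : ℂ) • ρ₂)
      + b * relativeEntropy ρ₂ ((a : ℂ) • ρ₁ + (b : ℂ) • ρ₂)
      = entropy ((a : ℂ) • ρ₁ + (b : ℂ) • ρ₂) - (a * entropy ρ₁ + b * entropy ρ₂) := by
  set σ := (a : ℂ) • ρ₁ + (b : ℂ) • ρ₂ with hσ
  have : (σ * cfc Real.log σ).trace.re
      = a * (ρ₁ * cfc Real.log σ).trace.re + b * (ρ₂ * cfc Real.log σ).trace.re := by
    conv_lhs => rw [hσ, Matrix.add_mul, ← hσ]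
    simp
  simp only [relativeEntropy, entropy]
  rw [this]
  ring

/-- The entropy lost under a channel, `S(σ) - S(Φ σ)`, is concave in the state. -/
theorem IsQuantumChannel.concave_entropy_sub (hΦ : IsQuantumChannel Φ) {ρ₁ ρ₂ : Matrix A A ℂ}
    (h₁ : ρ₁.PosSemidef) (h₂ : ρ₂.PosSemidef) {a b : ℝ} (ha : 0 ≤ a) (hb : 0 ≤ b)
    (hab : a + b = 1) :
    a * (entropy ρ₁ - entropy (Φ ρ₁)) + b * (entropy ρ₂ - entropy (Φ ρ₂))
      ≤ entropy ((a : ℂ) • ρ₁ + (b : ℂ) • ρ₂) - entropy (Φ ((a : ℂ) • ρ₁ + (b : ℂ) • ρ₂)) := by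
  -- Zero weights are treated apart: data processing needs `σ - a ρ₁ = b ρ₂ ≥ 0` with `a > 0`, and
  -- symmetrically.
  rcases ha.eq_or_lt with rfl | ha'
  · obtain rfl : b = 1 := by linarith
    simp
  rcases hb.eq_or_lt with rfl | hb'
  · obtain rfl : a = 1 := by linarith
    simp
  have ha₁ : ((a : ℂ) • ρ₁).PosSemidef := h₁.smul (by exact_mod_cast ha)
  have hb₂ : ((b : ℂ) • ρ₂).PosSemidef := h₂.smul (by exact_mod_cast hb)
  have hσ := ha₁.add hb₂
  have d₁ := hΦ.relativeEntropy_le h₁ hσ ha' (by simpa using hb₂)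
  have d₂ := hΦ.relativeEntropy_le h₂ hσ hb' (by simpa using ha₁)
  have e := sum_relativeEntropy ρ₁ ρ₂ a b
  have e' := sum_relativeEntropy (Φ ρ₁) (Φ ρ₂) a b
  simp only [map_add, map_smul] at d₁ d₂ ⊢
  have := mul_le_mul_of_nonneg_left d₁ ha
  have := mul_le_mul_of_nonneg_left d₂ hb
  linarith

end Channel

/-! ### Continuity of the entropy. -/

section Continuity

variable [DecidableEq A]

/-- Replaces `log`, discontinuous at `0`, by a function continuous on all of `ℝ`. -/
theorem entropy_eq_trace_cfc_negMulLog {ρ : Matrix A A ℂ} (hρ : ρ.IsHermitian) :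
    entropy ρ = (cfc Real.negMulLog ρ).trace.re := by
  obtain ⟨V, b, hV, -, hρV, -, hf⟩ := exists_diagonalConj hρ
  rw [entropy, hf, hf, trace_diagonalConj_re hV]
  conv_lhs => rw [hρV, trace_diagonalConj_mul_self_re hV]
  simp [Real.negMulLog]

open scoped Matrix.Norms.L2Operator in
theorem continuousOn_cfc_isHermitian {f : ℝ → ℝ} (hf : Continuous f) :
    ContinuousOn (cfc f : Matrix A A ℂ → Matrix A A ℂ) {M | M.IsHermitian} := by
  -- Matrices `M'` near `M` have norm below `‖M‖ + 1`, so their spectra lie in one compact ball.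
  refine ContinuousOn.cfc (s := fun M => Metric.closedBall 0 ((‖M‖ + 1) * ‖(1 : Matrix A A ℂ)‖)) f
    (fun M _ => isCompact_closedBall _ _) continuousOn_id (fun M _ => ?_) (fun M hM => hM)
    (fun _ _ => hf.continuousOn)
  refine mem_nhdsWithin_of_mem_nhds ?_
  filter_upwards [continuous_norm.continuousAt.eventually_lt_const (lt_add_one ‖M‖)] with M' hM'
  refine (spectrum.subset_closedBall_norm_mul M').trans (Metric.closedBall_subset_closedBall ?_)
  gcongr

theorem continuousOn_entropy :
    ContinuousOn (entropy : Matrix A A ℂ → ℝ) {M | M.IsHermitian} := by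
  have h : ContinuousOn (fun M : Matrix A A ℂ => (cfc Real.negMulLog M).trace.re)
      {M | M.IsHermitian} :=
    Complex.continuous_re.comp_continuousOn
      (continuous_id.matrix_trace.comp_continuousOn
        (continuousOn_cfc_isHermitian Real.continuous_negMulLog))
  exact h.congr fun M hM => entropy_eq_trace_cfc_negMulLog hM

end Continuity

/-! ### Attainment and concavity of the capacity-power function. -/

section CapacityPower

variable {E X : Type*} [DecidableEq B] [Fintype E] [DecidableEq E] [Fintype X]

omit [Fintype A] in
theorem averageState_add_smul (ρ : X → Matrix A A ℂ) (p q : X → ℝ) (a b : ℝ) :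
    averageState (a • p + b • q) ρ
      = (a : ℂ) • averageState p ρ + (b : ℂ) • averageState q ρ := by
  simp [averageState, Finset.smul_sum, ← Finset.sum_add_distrib, add_smul, mul_smul]

omit [Fintype A] in
theorem averageState_posSemidef {ρ : X → Matrix A A ℂ} (hρ : ∀ x, (ρ x).PosSemidef) {p : X → ℝ}
    (hp : p ∈ stdSimplex ℝ X) : (averageState p ρ).PosSemidef :=
  Matrix.posSemidef_sum _ fun x _ => (hρ x).smul (by exact_mod_cast hp.1 x)

omit [Fintype A] in
theorem continuous_averageState (ρ : X → Matrix A A ℂ) :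
    Continuous fun p => averageState p ρ := by
  unfold averageState
  fun_prop

omit [Fintype B] [DecidableEq B] in
theorem continuous_linearMap_matrix (Φ : Matrix A A ℂ →ₗ[ℂ] Matrix B B ℂ) : Continuous Φ :=
  Φ.continuous_of_finiteDimensional

theorem continuousOn_holevo {Φ : Matrix A A ℂ →ₗ[ℂ] Matrix B B ℂ}
    (hΦ : ∀ M : Matrix A A ℂ, M.PosSemidef → (Φ M).PosSemidef)
    {ρ : X → Matrix A A ℂ} (hρ : ∀ x, (ρ x).PosSemidef) :
    ContinuousOn (fun p => holevo Φ p ρ) (stdSimplex ℝ X) := by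
  refine ContinuousOn.sub ?_ (Continuous.continuousOn (by fun_prop))
  exact continuousOn_entropy.comp
    ((continuous_linearMap_matrix Φ).comp (continuous_averageState ρ)).continuousOn
    fun p hp => (hΦ _ (averageState_posSemidef hρ hp)).1

omit [Fintype A] in
/-- For degradable channels the private information is concave in the input distribution. -/
theorem concaveOn_privateInformation {N : Matrix A A ℂ →ₗ[ℂ] Matrix B B ℂ}
    (hN : ∀ M : Matrix A A ℂ, M.PosSemidef → (N M).PosSemidef)
    {D : Matrix B B ℂ →ₗ[ℂ] Matrix E E ℂ} (hD : IsQuantumChannel D)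
    {ρ : X → Matrix A A ℂ} (hρ : ∀ x, (ρ x).PosSemidef) :
    ConcaveOn ℝ (stdSimplex ℝ X) (privateInformation N (D ∘ₗ N) ρ) := by
  refine ⟨convex_stdSimplex ℝ X, fun p hp q hq a b ha hb hab => ?_⟩
  have h := hD.concave_entropy_sub (hN _ (averageState_posSemidef hρ hp))
    (hN _ (averageState_posSemidef hρ hq)) ha hb hab
  -- The signal-state entropies enter linearly in `p`, so they cancel from the concavity inequality.
  have hl : ∀ g : X → ℝ, ∑ x, (a • p + b • q) x * g x = a * ∑ x, p x * g x + b * ∑ x, q x * g x := by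
    intro g
    simp only [Pi.add_apply, Pi.smul_apply, smul_eq_mul, Finset.mul_sum, ← Finset.sum_add_distrib]
    exact Finset.sum_congr rfl fun x _ => by ring
  simp only [privateInformation, holevo, averageState_add_smul, hl, LinearMap.comp_apply,
    map_add, map_smul, smul_eq_mul] at h ⊢
  linarith

omit [DecidableEq B] in
theorem continuous_outputEnergy (N : Matrix A A ℂ →ₗ[ℂ] Matrix B B ℂ) (H : Matrix B B ℂ)
    (ρ : X → Matrix A A ℂ) : Continuous fun p => (H * N (averageState p ρ)).trace.re :=
  Complex.continuous_re.comp (continuous_const.matrix_mul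
    ((continuous_linearMap_matrix N).comp (continuous_averageState ρ))).matrix_trace

omit [DecidableEq B] in
theorem isCompact_admissible (N : Matrix A A ℂ →ₗ[ℂ] Matrix B B ℂ) (H : Matrix B B ℂ)
    (ρ : X → Matrix A A ℂ) (b : ℝ) : IsCompact (admissible N H ρ b) :=
  (isCompact_stdSimplex ℝ X).inter_right
    (isClosed_le continuous_const (continuous_outputEnergy N H ρ))

omit [Fintype A] [DecidableEq B] in
theorem add_smul_mem_admissible {N : Matrix A A ℂ →ₗ[ℂ] Matrix B B ℂ} {H : Matrix B B ℂ}
    {ρ : X → Matrix A A ℂ} {b₁ b₂ : ℝ} {p q : X → ℝ} (hp : p ∈ admissible N H ρ b₁)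
    (hq : q ∈ admissible N H ρ b₂) {a c : ℝ} (ha : 0 ≤ a) (hc : 0 ≤ c) (hac : a + c = 1) :
    a • p + c • q ∈ admissible N H ρ (a • b₁ + c • b₂) := by
  refine ⟨convex_stdSimplex ℝ X hp.1 hq.1 ha hc hac, ?_⟩
  have h1 := mul_le_mul_of_nonneg_left hp.2 ha
  have h2 := mul_le_mul_of_nonneg_left hq.2 hc
  rw [averageState_add_smul]
  simp only [map_add, map_smul, Matrix.mul_add, Matrix.mul_smul, Matrix.trace_add,
    Matrix.trace_smul, Complex.add_re, smul_eq_mul, Complex.re_ofReal_mul]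
  linarith

theorem isGreatest_privateCapacityPower {N : Matrix A A ℂ →ₗ[ℂ] Matrix B B ℂ}
    {Nc : Matrix A A ℂ →ₗ[ℂ] Matrix E E ℂ}
    (hN : ∀ M : Matrix A A ℂ, M.PosSemidef → (N M).PosSemidef)
    (hNc : ∀ M : Matrix A A ℂ, M.PosSemidef → (Nc M).PosSemidef) (H : Matrix B B ℂ)
    {ρ : X → Matrix A A ℂ} (hρ : ∀ x, (ρ x).PosSemidef) {b : ℝ}
    (hb : (admissible N H ρ b).Nonempty) :
    IsGreatest (privateInformation N Nc ρ '' admissible N H ρ b)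
      (privateCapacityPower N Nc H ρ b) :=
  ((isCompact_admissible N H ρ b).image_of_continuousOn
    (((continuousOn_holevo hN hρ).sub (continuousOn_holevo hNc hρ)).mono
      fun _ hp => hp.1)).isGreatest_sSup (hb.image _)

end CapacityPower

end PrivateCapacityPower

open PrivateCapacityPower in
theorem corollary2 {A B E X : Type*}
    [Fintype A] [DecidableEq A] [Fintype B] [DecidableEq B] [Fintype E] [DecidableEq E] [Fintype X]
    (N : Matrix A A ℂ →ₗ[ℂ] Matrix B B ℂ) (hN : IsQuantumChannel N)
    (U : Matrix (B × E) A ℂ) (hU : IsDilation N U)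
    (hdeg : IsDegradable N (complementary U))
    (H : Matrix B B ℂ) (hH : H.IsHermitian)
    (ρ : X → Matrix A A ℂ) (hρ : ∀ x, IsDensityMatrix (ρ x)) :
    (∀ b : ℝ, (admissible N H ρ b).Nonempty →
      IsGreatest (privateInformation N (complementary U) ρ '' admissible N H ρ b)
        (privateCapacityPower N (complementary U) H ρ b)) ∧
    ConcaveOn ℝ {b : ℝ | (admissible N H ρ b).Nonempty}
      (privateCapacityPower N (complementary U) H ρ) := by
  obtain ⟨D, hD, hDN⟩ := hdeg
  rw [hDN]
  have hmax : ∀ b : ℝ, (admissible N H ρ b).Nonempty →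
      IsGreatest (privateInformation N (D ∘ₗ N) ρ '' admissible N H ρ b)
        (privateCapacityPower N (D ∘ₗ N) H ρ b) := fun b hb =>
    isGreatest_privateCapacityPower (fun M => hN.map_posSemidef)
      (fun M hM => hD.map_posSemidef (hN.map_posSemidef hM)) H (fun x => (hρ x).1) hb
  refine ⟨hmax, ?_, ?_⟩
  · rintro b₁ ⟨p, hp⟩ b₂ ⟨q, hq⟩ a c ha hc hac
    exact ⟨_, add_smul_mem_admissible hp hq ha hc hac⟩
  · intro b₁ hb₁ b₂ hb₂ a c ha hc hac
    obtain ⟨p, hp, hpv⟩ := (hmax b₁ hb₁).1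
    obtain ⟨q, hq, hqv⟩ := (hmax b₂ hb₂).1
    have hmem := add_smul_mem_admissible hp hq ha hc hac
    -- The mixture of the two maximizers is a competitor for the mixed bound.
    rw [← hpv, ← hqv]
    exact ((concaveOn_privateInformation (fun M => hN.map_posSemidef) hD fun x => (hρ x).1).2
      hp.1 hq.1 ha hc hac).trans ((hmax _ ⟨_, hmem⟩).2 ⟨_, hmem, rfl⟩)
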